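/- Let $\mathbb K$ be $\mathbb R$ or $\mathbb C$; Banach spaces and Lipschitz functions below are over $\mathbb K$. **Notation.** A pointed metric space is a metric space with a base point $0$. For a pointed metric space $X$ and a Banach space $E$, $\mathrm{Lip}_0(X,E)$ is the space of Lipschitz maps $f\colon X\to E$ with $f(0)=0$, $\mathrm{Lip}(f)$ is the least Lipschitz constant of $f$, and $X^\#=\mathrm{Lip}_0(X,\mathbb K)$. For pointed metric spaces $X,Y$, $\mathrm{Lip}_0(X,Y)$ is the set of base-point preserving Lipschitz maps. The Lipschitz tensor product $X\boxtimes E$ is the linear span of the functionals $\delta_{(x,y)}\boxtimes e\colon f\mapsto\langle f(x)-f(y),e\rangle$ on $\mathrm{Lip}_0(X,E^*)$, where $x,y\in X$ and $e\in E$. For $h\in\mathrm{Lip}_0(X,Y)$ and a bounded linear operator $T\colon E\to F$, the linear map $h\boxtimes T\colon X\boxtimes E\to Y\boxtimes F$ is given by $\delta_{(x,y)}\boxtimes e\mapsto\delta_{(h(x),h(y))}\boxtimes T(e)$. Let $\kappa_E\colon E\to E^{**}$ be the canonical injection. **Cross-norms.** A generic Lipschitz cross-norm $\alpha$ assigns to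 each pointed metric space $X$ and each Banach space $E$ a norm $\alpha(\cdot;X,E)$ on $X\boxtimes E$ such that 1. $\alpha(\delta_{(x,y)}\boxtimes e;X,E)=d(x,y)\|e\|$; 2. (dualizable) $\bigl|\sum_i (g(x_i)-g(y_i))\langle\phi,e_i\rangle\bigr|\le\mathrm{Lip}(g)\|\phi\|\,\alpha(u;X,E)$ for all $u=\sum_i\delta_{(x_i,y_i)}\boxtimes e_i\in X\boxtimes E$, $g\in X^\#$, $\phi\in E^*$; 3. (metric mapping property) $\alpha((h\boxtimes T)u;Y,F)\le\mathrm{Lip}(h)\|T\|\,\alpha(u;X,E)$ for all $u\in X\boxtimes E$, $h\in \mathrm{Lip}_0(X,Y)$ and bounded linear $T\colon E\to F$. It is finitely generated if for all $X$, $E$ and $u\in X\boxtimes E$, $\alpha(u;X,E)$ is the infimum of $\alpha(u;X_0,E_0)$ over all finite subsets $X_0\subseteq X$ containing $0$ and all finite-dimensional subspaces $E_0\subseteq E$ with $u\in X_0\boxtimes E_0$ (regarded as a subspace of $X\boxtimes E$ through the canonical injections). We write $X\boxtimes_\alpha E$ for $X\boxtimes E$ with the norm $\alpha$, and $X\widehat\boxtimes_\alpha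 E$ for its completion. **Ideals.** A generic Lipschitz operator Banach ideal $A$ assigns to each pointed metric space $X$ and each Banach space $E$ a linear subspace $A(X,E)$ of $\mathrm{Lip}_0(X,E)$ with a complete norm $\|\cdot\|_A$ such that 1. for $g\in X^\#$ and $e\in E$, the map $g\cdot e\colon x\mapsto g(x)e$ lies in $A(X,E)$ and $\|g\cdot e\|_A\le\mathrm{Lip}(g)\|e\|$; 2. $\mathrm{Lip}(f)\le\|f\|_A$ for all $f\in A(X,E)$; 3. if $f\in A(X,E)$, $h\in\mathrm{Lip}_0(Z,X)$ and $S\colon E\to F$ is bounded and linear, then $S f h\in A(Z,F)$ and $\|Sfh\|_A\le\|S\|\,\|f\|_A\,\mathrm{Lip}(h)$. For $f\in\mathrm{Lip}_0(X,E)$ let $\|f\|_{A^{\max}}\in[0,\infty]$ be the supremum of $\|Q_L\circ f|_Y\|_A$ over all finite $Y\subseteq X$ containing $0$ and all closed finite-codimensional subspaces $L\subseteq E$, where $Q_L\colon E\to E/L$ is the quotient map. The ideal $A$ is maximal if, for all $X$ and $E$, $A(X,E)=\{f\in\mathrm{Lip}_0(X,E):\|f\|_{A^{\max}}<\infty\}$,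 with $\|\cdot\|_A=\|\cdot\|_{A^{\max}}$ there. **Association.** $A$ and $\alpha$ are associated if, for every finite pointed metric space $X$ and every finite-dimensional Banach space $E$, the map $f\mapsto(u\mapsto u(f))$ is an isometric isomorphism of $A(X,E^*)$ onto $(X\boxtimes_\alpha E)^*$. **Theorem.** Let $A$ be a maximal generic Lipschitz operator Banach ideal and $\alpha$ a finitely generated generic Lipschitz cross-norm which are associated with each other. Then for every pointed metric space $X$ and every Banach space $E$ the relations $$A(X,E^*)=(X\widehat\boxtimes_\alpha E)^*,\qquad A(X,E)=(X\widehat\boxtimes_\alpha E^*)^*\cap\mathrm{Lip}_0(X,E)$$ hold isometrically. That is: * The map sending $f\in A(X,E^*)$ to the continuous extension of $u\mapsto u(f)$ is an isometric isomorphism of $A(X,E^*)$ onto $(X\widehat\boxtimes_\alpha E)^*$. * A map $f\in\mathrm{Lip}_0(X,E)$ belongs to $A(X,E)$ if and only if the functional $u\mapsto u(\kappa_E\circ f)$ on $X\boxtimes E^*$ extends to a continuous linear functional on $X\widehat\boxtimes_\alpha E^*$. In this case the norm of the extension is $\|f\|_A$. -/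

import Mathlib

open Filter Topology
open scoped ENNReal

universe u v

noncomputable section

/-- A pointed metric space: a metric space with a distinguished base point. -/
structure PointedMetricSpace : Type (u + 1) where
  carrier : Type u
  [metric : MetricSpace carrier]
  base : carrier

namespace PointedMetricSpace

instance : CoeSort PointedMetricSpace.{u} (Type u) := ⟨PointedMetricSpace.carrier⟩

instance (X : PointedMetricSpace.{u}) : MetricSpace X := X.metric

/-- A finite subset containing the base point, as a pointed metric space. -/
def sub (X : PointedMetricSpace.{u}) (Y : Finset X) (hY : X.base ∈ Y) : PointedMetricSpace.{u} where
  carrier := {x : X // x ∈ Y}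
  base := ⟨X.base, hY⟩

/-- A base-point preserving Lipschitz map between pointed metric spaces. -/
structure LipMap (X Y : PointedMetricSpace.{u}) : Type u where
  toFun : X → Y
  map_base : toFun X.base = Y.base
  lipschitz : ∃ K : NNReal, LipschitzWith K toFun

/-- The identity of `X`. -/
def LipMap.id (X : PointedMetricSpace.{u}) : LipMap X X :=
  ⟨fun x => x, rfl, 1, LipschitzWith.id⟩

/-- The canonical injection of a finite subset containing the base point. -/
def incl (X : PointedMetricSpace.{u}) (Y : Finset X) (hY : X.base ∈ Y) : LipMap (X.sub Y hY) X :=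
  ⟨Subtype.val, rfl, 1, LipschitzWith.subtype_val _⟩

end PointedMetricSpace

open PointedMetricSpace

/-- The least Lipschitz constant of a Lipschitz map. -/
def lipConst {X : Type*} {Y : Type*} [PseudoMetricSpace X] [PseudoMetricSpace Y] (f : X → Y) : ℝ :=
  sInf {C : ℝ | 0 ≤ C ∧ ∀ x y, dist (f x) (f y) ≤ C * dist x y}

section Lip

variable (𝕜 : Type) [RCLike 𝕜]

/-- The space of Lipschitz maps from `X` to `E` which vanish at the base point. -/
def Lip0 (X : PointedMetricSpace.{u}) (E : Type v) [NormedAddCommGroup E] [NormedSpace 𝕜 E] :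
    Submodule 𝕜 (X → E) where
  carrier := {f | f X.base = 0 ∧ ∃ K : NNReal, LipschitzWith K f}
  zero_mem' := ⟨rfl, 0, LipschitzWith.const 0⟩
  add_mem' := by
    rintro f g ⟨hf, K, hK⟩ ⟨hg, L, hL⟩
    exact ⟨by simp [hf, hg], K + L, hK.add hL⟩
  smul_mem' := by
    rintro c f ⟨hf, K, hK⟩
    exact ⟨by simp [hf], ‖c‖₊ * K, (lipschitzWith_smul c).comp hK⟩

variable {𝕜}
variable {X Y Z : PointedMetricSpace.{u}}
variable {E F : Type v} [NormedAddCommGroup E] [NormedSpace 𝕜 E]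
  [NormedAddCommGroup F] [NormedSpace 𝕜 F]

/-- The composition `S ∘ f ∘ h`, linear in `f`. -/
def Lip0.comp (S : E →L[𝕜] F) (h : LipMap Z X) : Lip0 𝕜 X E →ₗ[𝕜] Lip0 𝕜 Z F where
  toFun f := ⟨fun z => S (f.1 (h.toFun z)), by
    obtain ⟨hf, K, hK⟩ := f.2
    obtain ⟨L, hL⟩ := h.lipschitz
    exact ⟨by simp [h.map_base, hf], _, S.lipschitz.comp (hK.comp hL)⟩⟩
  map_add' f g := by ext z; simp
  map_smul' c f := by ext z; simp

/-- The rank-one operator `g · e : x ↦ g(x) e`. -/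
def Lip0.rankOne (g : Lip0 𝕜 X 𝕜) (e : E) : Lip0 𝕜 X E :=
  ⟨fun x => g.1 x • e, by
    obtain ⟨hg, K, hK⟩ := g.2
    exact ⟨by simp [hg], _, (ContinuousLinearMap.toSpanSingleton 𝕜 e).lipschitz.comp hK⟩⟩

/-- The operator `κ_E ∘ f`, where `κ_E : E → E**` is the canonical injection. -/
def Lip0.toBidual : Lip0 𝕜 X E →ₗ[𝕜] Lip0 𝕜 X (StrongDual 𝕜 (StrongDual 𝕜 E)) :=
  Lip0.comp (NormedSpace.inclusionInDoubleDual 𝕜 E) (LipMap.id X)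

/-- The functional `δ_(x,y) ⊠ e : f ↦ ⟨f(x) - f(y), e⟩` on `Lip_0(X, E*)`. -/
def deltaTensor (x y : X) (e : E) : Module.Dual 𝕜 (Lip0 𝕜 X (StrongDual 𝕜 E)) where
  toFun f := (f.1 x - f.1 y) e
  map_add' f g := by simp; ring
  map_smul' c f := by simp; ring

variable (𝕜 X E) in
/-- The Lipschitz tensor product `X ⊠ E`. -/
def LipTensor : Submodule 𝕜 (Module.Dual 𝕜 (Lip0 𝕜 X (StrongDual 𝕜 E))) :=
  Submodule.span 𝕜 {u | ∃ (x y : X) (e : E), u = deltaTensor x y e}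

/-- `δ_(x,y) ⊠ e` as an element of `X ⊠ E`. -/
def LipTensor.delta (x y : X) (e : E) : LipTensor 𝕜 X E :=
  ⟨deltaTensor x y e, Submodule.subset_span ⟨x, y, e, rfl⟩⟩

/-- The adjoint `T* : F* → E*` of `T : E → F`. -/
def dualOp (T : E →L[𝕜] F) : StrongDual 𝕜 F →L[𝕜] StrongDual 𝕜 E :=
  (ContinuousLinearMap.compL 𝕜 E F 𝕜).flip T

theorem deltaTensor_dualMap (h : LipMap X Y) (T : E →L[𝕜] F) (x y : X) (e : E) :
    (Lip0.comp (dualOp T) h).dualMap (deltaTensor x y e)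
      = deltaTensor (h.toFun x) (h.toFun y) (T e) := by
  ext f
  simp [deltaTensor, Lip0.comp, dualOp]

/-- The linear operator `h ⊠ T : X ⊠ E → Y ⊠ F`, `u ↦ (f ↦ u(T* ∘ f ∘ h))`; it sends
`δ_(x,y) ⊠ e` to `δ_(h(x),h(y)) ⊠ T(e)`, see `LipTensor.map_delta`. -/
def LipTensor.map (h : LipMap X Y) (T : E →L[𝕜] F) : LipTensor 𝕜 X E →ₗ[𝕜] LipTensor 𝕜 Y F :=
  (Lip0.comp (dualOp T) h).dualMap.restrict (p := LipTensor 𝕜 X E) (q := LipTensor 𝕜 Y F) (by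
    intro u hu
    induction hu using Submodule.span_induction with
    | mem u hu =>
      obtain ⟨x, y, e, rfl⟩ := hu
      rw [deltaTensor_dualMap]
      exact Submodule.subset_span ⟨_, _, _, rfl⟩
    | zero => simp
    | add a b _ _ ha hb => rw [map_add]; exact Submodule.add_mem _ ha hb
    | smul c a _ ha => rw [map_smul]; exact Submodule.smul_mem _ c ha)

theorem LipTensor.map_delta (h : LipMap X Y) (T : E →L[𝕜] F) (x y : X) (e : E) :
    LipTensor.map h T (LipTensor.delta x y e)
      = LipTensor.delta (h.toFun x) (h.toFun y) (T e) :=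
  Subtype.ext (deltaTensor_dualMap h T x y e)

end Lip

/-- A generic Lipschitz cross-norm: a norm on `X ⊠ E` for every pointed metric space `X` and every
Banach space `E`, which is a Lipschitz cross-norm, dualizable, and has the metric mapping
property. -/
structure GenericLipCrossNorm (𝕜 : Type) [RCLike 𝕜] where
  norm : ∀ (X : PointedMetricSpace.{u}) (E : Type v) [NormedAddCommGroup E] [NormedSpace 𝕜 E]
    [CompleteSpace E], Seminorm 𝕜 (LipTensor 𝕜 X E)
  eq_zero : ∀ (X : PointedMetricSpace.{u}) (E : Type v) [NormedAddCommGroup E] [NormedSpace 𝕜 E]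
    [CompleteSpace E] (u : LipTensor 𝕜 X E), norm X E u = 0 → u = 0
  cross : ∀ (X : PointedMetricSpace.{u}) (E : Type v) [NormedAddCommGroup E] [NormedSpace 𝕜 E]
    [CompleteSpace E] (x y : X) (e : E), norm X E (LipTensor.delta x y e) = dist x y * ‖e‖
  /- The value of `u = ∑ δ_(x_i,y_i) ⊠ e_i` at `g · φ` is `∑ (g(x_i) - g(y_i)) φ(e_i)`. -/
  dualizable : ∀ (X : PointedMetricSpace.{u}) (E : Type v) [NormedAddCommGroup E] [NormedSpace 𝕜 E]
    [CompleteSpace E] (g : Lip0 𝕜 X 𝕜) (φ : StrongDual 𝕜 E) (u : LipTensor 𝕜 X E),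
    ‖u.1 (Lip0.rankOne g φ)‖ ≤ lipConst g.1 * ‖φ‖ * norm X E u
  metric_mapping : ∀ (X Y : PointedMetricSpace.{u}) (E F : Type v)
    [NormedAddCommGroup E] [NormedSpace 𝕜 E] [CompleteSpace E]
    [NormedAddCommGroup F] [NormedSpace 𝕜 F] [CompleteSpace F]
    (h : LipMap X Y) (T : E →L[𝕜] F) (u : LipTensor 𝕜 X E),
    norm Y F (LipTensor.map h T u) ≤ lipConst h.toFun * ‖T‖ * norm X E u

/-- A generic Lipschitz operator Banach ideal: a linear subspace `A(X, E)` of `Lip_0(X, E)` with a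
norm, for every pointed metric space `X` and every Banach space `E`, subject to the conditions
below. -/
structure GenericLipIdeal (𝕜 : Type) [RCLike 𝕜] where
  carrier : ∀ (X : PointedMetricSpace.{u}) (E : Type v) [NormedAddCommGroup E] [NormedSpace 𝕜 E]
    [CompleteSpace E], Submodule 𝕜 (Lip0 𝕜 X E)
  norm : ∀ (X : PointedMetricSpace.{u}) (E : Type v) [NormedAddCommGroup E] [NormedSpace 𝕜 E]
    [CompleteSpace E], Seminorm 𝕜 (carrier X E)
  eq_zero : ∀ (X : PointedMetricSpace.{u}) (E : Type v) [NormedAddCommGroup E] [NormedSpace 𝕜 E]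
    [CompleteSpace E] (f : carrier X E), norm X E f = 0 → f = 0
  rankOne : ∀ (X : PointedMetricSpace.{u}) (E : Type v) [NormedAddCommGroup E] [NormedSpace 𝕜 E]
    [CompleteSpace E] (g : Lip0 𝕜 X 𝕜) (e : E),
    ∃ hmem : Lip0.rankOne g e ∈ carrier X E, norm X E ⟨_, hmem⟩ ≤ lipConst g.1 * ‖e‖
  lip_le : ∀ (X : PointedMetricSpace.{u}) (E : Type v) [NormedAddCommGroup E] [NormedSpace 𝕜 E]
    [CompleteSpace E] (f : carrier X E), lipConst f.1.1 ≤ norm X E f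
  /- Every Cauchy sequence for the norm of `A(X, E)` converges. -/
  complete : ∀ (X : PointedMetricSpace.{u}) (E : Type v) [NormedAddCommGroup E] [NormedSpace 𝕜 E]
    [CompleteSpace E] (f : ℕ → carrier X E),
    (∀ ε > 0, ∃ N, ∀ m ≥ N, ∀ n ≥ N, norm X E (f m - f n) < ε) →
      ∃ g : carrier X E, Tendsto (fun n => norm X E (f n - g)) atTop (𝓝 0)
  ideal : ∀ (X Z : PointedMetricSpace.{u}) (E F : Type v)
    [NormedAddCommGroup E] [NormedSpace 𝕜 E] [CompleteSpace E]
    [NormedAddCommGroup F] [NormedSpace 𝕜 F] [CompleteSpace F]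
    (f : carrier X E) (h : LipMap Z X) (S : E →L[𝕜] F),
    ∃ hmem : Lip0.comp S h f.1 ∈ carrier Z F,
      norm Z F ⟨_, hmem⟩ ≤ ‖S‖ * norm X E f * lipConst h.toFun

section Generic

variable {𝕜 : Type} [RCLike 𝕜]

namespace GenericLipCrossNorm

variable (α : GenericLipCrossNorm.{u, v} 𝕜)
variable (X : PointedMetricSpace.{u}) (E : Type v) [NormedAddCommGroup E] [NormedSpace 𝕜 E]
  [CompleteSpace E]

/-- The space `X ⊠_α E`, that is, `X ⊠ E` with the norm `α`. -/
def Space (_ : GenericLipCrossNorm.{u, v} 𝕜) (X : PointedMetricSpace.{u}) (E : Type v)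
    [NormedAddCommGroup E] [NormedSpace 𝕜 E] [CompleteSpace E] : Type (max u v) :=
  LipTensor 𝕜 X E

instance : NormedAddCommGroup (α.Space X E) :=
  AddGroupNorm.toNormedAddCommGroup (E := LipTensor 𝕜 X E)
    { (α.norm X E).toAddGroupSeminorm with
      eq_zero_of_map_eq_zero' := α.eq_zero X E }

instance : Module 𝕜 (α.Space X E) := inferInstanceAs (Module 𝕜 (LipTensor 𝕜 X E))

instance : NormedSpace 𝕜 (α.Space X E) where
  norm_smul_le c u := (map_smul_eq_mul (α.norm X E) c u).le

/-- The element `u` of `X ⊠ E`, seen in `X ⊠_α E`. -/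
def toSpace (u : LipTensor 𝕜 X E) : α.Space X E := u

/-- `α` is finitely generated: `α(u; X, E)` is the infimum of `α(u; X₀, E₀)` over all finite
`X₀ ⊆ X` containing the base point and all finite-dimensional subspaces `E₀ ⊆ E` such that
`u ∈ X₀ ⊠ E₀`, where `X₀ ⊠ E₀` is regarded as a subset of `X ⊠ E` via the canonical injections. -/
def IsFinitelyGenerated : Prop :=
  ∀ (X : PointedMetricSpace.{u}) (E : Type v) [NormedAddCommGroup E] [NormedSpace 𝕜 E]
    [CompleteSpace E] (u : LipTensor 𝕜 X E),
    IsGLB {r : ℝ | ∃ (X₀ : Finset X) (hX₀ : X.base ∈ X₀) (E₀ : Submodule 𝕜 E)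
        (_ : FiniteDimensional 𝕜 E₀) (u₀ : LipTensor 𝕜 (X.sub X₀ hX₀) E₀),
        LipTensor.map (X.incl X₀ hX₀) E₀.subtypeL u₀ = u ∧
        haveI : CompleteSpace E₀ := FiniteDimensional.complete 𝕜 E₀
        r = α.norm (X.sub X₀ hX₀) E₀ u₀}
      (α.norm X E u)

end GenericLipCrossNorm

namespace GenericLipIdeal

variable (A : GenericLipIdeal.{u, v} 𝕜)
variable (X : PointedMetricSpace.{u}) (E : Type v) [NormedAddCommGroup E] [NormedSpace 𝕜 E]
  [CompleteSpace E]

/-- The Banach space `A(X, E)`, that is, the subspace `A(X, E)` of `Lip_0(X, E)` with the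
norm `‖·‖_A`. -/
def Space : Type (max u v) := A.carrier X E

instance : NormedAddCommGroup (A.Space X E) :=
  AddGroupNorm.toNormedAddCommGroup (E := A.carrier X E)
    { (A.norm X E).toAddGroupSeminorm with
      eq_zero_of_map_eq_zero' := A.eq_zero X E }

instance : Module 𝕜 (A.Space X E) := inferInstanceAs (Module 𝕜 (A.carrier X E))

instance : NormedSpace 𝕜 (A.Space X E) where
  norm_smul_le c f := (map_smul_eq_mul (A.norm X E) c f).le

variable {A X E} in
/-- The Lipschitz operator underlying an element of `A(X, E)`. -/
def Space.toLip0 (f : A.Space X E) : Lip0 𝕜 X E := Subtype.val f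

open Classical in
variable {X E} in
/-- `‖f‖_A` as an extended number, with value `∞` when `f` is not in `A(X, E)`. -/
def extNorm (f : Lip0 𝕜 X E) : ℝ≥0∞ :=
  if hf : f ∈ A.carrier X E then ENNReal.ofReal (A.norm X E ⟨f, hf⟩) else ∞

variable {X E} in
/-- `‖f‖_{A^max}`: the supremum of `‖Q_L ∘ f ∘ I_Y‖_A` over all finite `Y ⊆ X` containing the base
point and all closed subspaces `L ⊆ E` of finite codimension. -/
def maxNorm (f : Lip0 𝕜 X E) : ℝ≥0∞ :=
  ⨆ (Y : Finset X) (hY : X.base ∈ Y) (L : Submodule 𝕜 E) (_ : IsClosed (L : Set E))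
    (_ : FiniteDimensional 𝕜 (E ⧸ L)),
    A.extNorm (Lip0.comp L.mkQL (X.incl Y hY) f)

/-- `A` is maximal: `A(X, E) = A^max(X, E)`, with equal norms, for all `X` and `E`. -/
def IsMaximal : Prop :=
  ∀ (X : PointedMetricSpace.{u}) (E : Type v) [NormedAddCommGroup E] [NormedSpace 𝕜 E]
    [CompleteSpace E],
    (∀ f : Lip0 𝕜 X E, f ∈ A.carrier X E ↔ A.maxNorm f < ∞) ∧
    ∀ f : A.carrier X E, ENNReal.ofReal (A.norm X E f) = A.maxNorm f.1

end GenericLipIdeal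

/-- `A` and `α` are associated: `A(X, E*) = (X ⊠_α E)*` holds isometrically, via the canonical map
which sends `f` to the functional `u ↦ u(f)`, for all finite `X` and finite-dimensional `E`. -/
def AreAssociated (A : GenericLipIdeal.{u, v} 𝕜) (α : GenericLipCrossNorm.{u, v} 𝕜) : Prop :=
  ∀ (X : PointedMetricSpace.{u}) (E : Type v) [NormedAddCommGroup E] [NormedSpace 𝕜 E]
    [CompleteSpace E] [Finite X] [FiniteDimensional 𝕜 E],
    ∃ Φ : A.Space X (StrongDual 𝕜 E) ≃ₗᵢ[𝕜] StrongDual 𝕜 (α.Space X E),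
      ∀ (f : A.Space X (StrongDual 𝕜 E)) (u : LipTensor 𝕜 X E),
        Φ f (α.toSpace X E u) = u.1 f.toLip0

end Generic

end

/-! Everything reduces to one equivalence: `‖f‖_A ≤ C` exactly when `u ↦ u(κ_E ∘ f)` is bounded by
`C` on `X ⊠_α E*` (`bounded_iff_bidualBounded`). Maximality tests the left side on the finite pieces
`Q_L ∘ f|_Y`, and finite generation tests the right side on the spaces `Y ⊠_α G` with `G` a
finite-dimensional subspace of `E*`. The pieces match: the common kernel `L` of the functionals in
`G` has finite codimension and `G` acts on `E/L`, while conversely `Q_L*` embeds `(E/L)*` into `E*`.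
On each piece association applies, since a finite-dimensional space is its own bidual.

For maps into `E*` this criterion concerns `X ⊠_α E**`, and `E**` has to be replaced by `E`
(`bidualBounded_iff_of_dual`). One direction restricts along `κ_E`. The other is local reflexivity:
a tensor over a finite `Y` and a finite-dimensional `G → E**` sees only the finitely many
functionals `f(y)`, so `G` can be moved into `E` at the cost of a factor `1 + ε`.

The bounds for all `C` determine both membership and norm, which gives isometric embeddings into the
duals of the completions. For `E*`-valued maps the embedding is onto, because the cross-norm
identity makes every continuous functional come from a Lipschitz map. -/

open PointedMetricSpace

/-! ### Local reflexivity -/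

section LocalReflexivity

variable {𝕜 : Type*} [RCLike 𝕜]
variable {E : Type*} [NormedAddCommGroup E] [NormedSpace 𝕜 E]

/-- The norm of a functional on a finite `ℓ_∞`-sum dominates the sum of the norms of its
coordinates. -/
theorem sum_norm_comp_single_le {ι : Type*} [Fintype ι] [DecidableEq ι]
    (ψ : StrongDual 𝕜 (ι → E)) :
    ∑ j, ‖ψ.comp (ContinuousLinearMap.single 𝕜 (fun _ : ι => E) j)‖ ≤ ‖ψ‖ := by
  set χ : ι → StrongDual 𝕜 E := fun j => ψ.comp (ContinuousLinearMap.single 𝕜 (fun _ : ι => E) j)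
  have hψ : ∀ w : ι → E, ψ w = ∑ j, χ j (w j) := fun w => by
    conv_lhs => rw [← Finset.univ_sum_single w]
    simp [χ]
  have key : ∀ η > 0, ∑ j, ‖χ j‖ ≤ ‖ψ‖ + ∑ _j : ι, η := by
    intro η hη
    have hw : ∀ j, ∃ w : E, ‖w‖ ≤ 1 ∧ ∃ r : ℝ, χ j w = (r : 𝕜) ∧ ‖χ j‖ - η ≤ r := by
      intro j
      obtain ⟨x, hx, hxr⟩ := (χ j).exists_lt_apply_of_lt_opNorm (sub_lt_self ‖χ j‖ hη)
      -- A unimodular rotation makes each `χ j (w j)` real and nonnegative, so nothing cancels in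
      -- the sum.
      obtain ⟨c, hc, hcx⟩ := RCLike.exists_norm_eq_mul_self (χ j x)
      refine ⟨c • x, by rw [norm_smul, hc, one_mul]; exact hx.le, ‖χ j x‖, ?_, hxr.le⟩
      rw [map_smul, smul_eq_mul, ← hcx]
    choose w hw1 r hr hrη using hw
    have h1 : ψ w = ((∑ j, r j : ℝ) : 𝕜) := by simp [hψ, hr]
    have h2 : ‖ψ w‖ ≤ ‖ψ‖ := by
      simpa using ψ.le_of_opNorm_le_of_le le_rfl
        ((pi_norm_le_iff_of_nonneg zero_le_one).2 hw1)
    rw [h1, RCLike.norm_ofReal] at h2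
    calc ∑ j, ‖χ j‖ ≤ ∑ j, (r j + η) := Finset.sum_le_sum fun j _ => by linarith [hrη j]
      _ = ∑ j, r j + ∑ _j : ι, η := Finset.sum_add_distrib
      _ ≤ _ := by gcongr; exact (le_abs_self _).trans h2
  refine le_of_forall_pos_le_add fun ε hε => ?_
  -- The `+ 1` covers an empty index set.
  refine (key (ε / (Fintype.card ι + 1)) (by positivity)).trans ?_
  gcongr
  rw [Finset.sum_const, Finset.card_univ, nsmul_eq_mul, ← mul_div_assoc, div_le_iff₀ (by positivity)]
  nlinarith

/-- Operators on a finite-dimensional space are normed, up to `1 + ε`, by finitely many points of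
the unit ball. -/
theorem exists_finset_norming (𝕜 : Type*) [RCLike 𝕜] (G : Type*) [NormedAddCommGroup G]
    [NormedSpace 𝕜 G] [FiniteDimensional 𝕜 G] (E : Type*) [NormedAddCommGroup E] [NormedSpace 𝕜 E]
    {ε : ℝ} (hε : 0 < ε) :
    ∃ t : Finset G, (∀ g ∈ t, ‖g‖ ≤ 1) ∧
      ∀ T : G →L[𝕜] E, ‖T‖ ≤ (1 + ε) * ‖fun g : t => T g‖ := by
  have : ProperSpace G := FiniteDimensional.proper_rclike 𝕜 G
  -- A `δ`-net gives `‖T‖ ≤ m + δ‖T‖`, and this `δ` satisfies `1 / (1 - δ) = 1 + ε`.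
  set δ := ε / (1 + ε) with hδ
  obtain ⟨t, ht, htf, hcov⟩ := finite_cover_balls_of_compact (isCompact_closedBall (0 : G) 1)
    (show 0 < δ by positivity)
  refine ⟨htf.toFinset, fun g hg => by simpa using ht (htf.mem_toFinset.1 hg), fun T => ?_⟩
  set m := ‖fun g : htf.toFinset => T g‖
  have h : ‖T‖ ≤ m + ‖T‖ * δ := by
    refine le_of_forall_lt fun r hr => ?_
    obtain ⟨x, hx, hxr⟩ := T.exists_lt_apply_of_lt_opNorm hr
    obtain ⟨g, hg, hgx⟩ := Set.mem_iUnion₂.1 (hcov (show x ∈ Metric.closedBall 0 1 by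
      simpa using hx.le))
    rw [mem_ball_iff_norm] at hgx
    have h1 : ‖T g‖ ≤ m :=
      norm_le_pi_norm (fun g : htf.toFinset => T g) ⟨g, htf.mem_toFinset.2 hg⟩
    have h2 : ‖T (x - g)‖ ≤ ‖T‖ * δ := T.le_of_opNorm_le_of_le le_rfl hgx.le
    rw [map_sub] at h2
    linarith [norm_sub_norm_le (T x) (T g)]
  have h3 : ‖T‖ * (1 / (1 + ε)) ≤ m := by
    have : 1 / (1 + ε) = 1 - δ := by rw [hδ]; field_simp; ring
    rw [this]; linarith
  rw [mul_one_div, div_le_iff₀ (by positivity)] at h3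
  linarith

variable {G : Type*} [NormedAddCommGroup G] [NormedSpace 𝕜 G] [FiniteDimensional 𝕜 G]
variable {ι : Type*} [Finite ι]

/-- Let `T₀ : G → E` interpolate a contraction `J : G → E**` on the functionals `m i`. Then a
functional of norm at most `1` on the operators `G → E` which depends only on the values `m i (T g)`
has absolute value at most `1` at `T₀`. -/
theorem norm_apply_le_of_interpolates (J : G →ₗ[𝕜] StrongDual 𝕜 (StrongDual 𝕜 E))
    (hJ : ∀ g, ‖J g‖ ≤ ‖g‖)
    (m : ι → StrongDual 𝕜 E) (T₀ : G →L[𝕜] E) (hT₀ : ∀ i g, m i (T₀ g) = J g (m i))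
    (Λ : StrongDual 𝕜 (G →L[𝕜] E)) (hΛ : ‖Λ‖ ≤ 1)
    (hN : ∀ T : G →L[𝕜] E, (∀ i g, m i (T g) = 0) → Λ T = 0) : ‖Λ T₀‖ ≤ 1 := by
  classical
  refine le_of_forall_pos_le_add fun ε hε => ?_
  obtain ⟨t, ht, hnorm⟩ := exists_finset_norming 𝕜 G E hε
  let ev : (G →L[𝕜] E) →ₗ[𝕜] (t → E) :=
    { toFun := fun T g => T g, map_add' := fun _ _ => rfl, map_smul' := fun _ _ => rfl }
  have hbd : ∀ T, ‖Λ T‖ ≤ (1 + ε) * ‖ev T‖ := fun T =>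
    ((Λ.le_of_opNorm_le hΛ T).trans_eq (one_mul _)).trans (hnorm T)
  -- By `hbd`, `Λ` factors through the range of `ev` in the `ℓ_∞`-sum with norm at most `1 + ε`;
  -- Hahn–Banach extends it to the whole sum.
  obtain ⟨ψ, hψ, hψn⟩ := exists_extension_norm_eq (LinearMap.range ev)
    ((Λ : (G →L[𝕜] E) →ₗ[𝕜] 𝕜).compLeftInverse ev)
  have hψT : ∀ T, ψ (ev T) = Λ T := fun T => by
    rw [hψ ⟨ev T, T, rfl⟩]
    exact LinearMap.compLeftInverse_apply_of_bdd _ _ ⟨_, hbd⟩ T _ rfl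
  have hψle : ‖ψ‖ ≤ 1 + ε := by
    rw [hψn]
    refine ContinuousLinearMap.opNorm_le_bound _ (by positivity) ?_
    rintro ⟨_, T, rfl⟩
    rw [LinearMap.compLeftInverse_apply_of_bdd _ _ ⟨_, hbd⟩ T _ rfl]
    exact hbd T
  set χ : t → StrongDual 𝕜 E := fun j => ψ.comp (ContinuousLinearMap.single 𝕜 (fun _ : t => E) j)
  have hχ : ∀ w : t → E, ψ w = ∑ j, χ j (w j) := fun w => by
    conv_lhs => rw [← Finset.univ_sum_single w]
    simp [χ]
  have hχle : ∑ j, ‖χ j‖ ≤ 1 + ε := (sum_norm_comp_single_le ψ).trans hψle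
  have hΛsum : ∀ T, Λ T = ∑ j : t, χ j (T j) := fun T => by rw [← hψT, hχ]; rfl
  let b := Module.finBasis 𝕜 G
  let μ : Fin (Module.finrank 𝕜 G) → StrongDual 𝕜 E := fun k => ∑ j : t, b.repr j k • χ j
  have hμΛ : ∀ k e, Λ ((b.coord k).toContinuousLinearMap.smulRight e) = μ k e := fun k e => by
    rw [hΛsum]; simp [μ]
  have hμ : ∀ k, μ k (T₀ (b k)) = J (b k) (μ k) := by
    intro k
    -- If all `m i` vanish at `e`, the operator `g ↦ b_k*(g) e` is annihilated by the `m i`, hence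
    -- by `Λ`. So `μ k` vanishes on the common kernel of the `m i` and lies in their span, where
    -- `T₀` interpolates `J`.
    have hmem : ((μ k : StrongDual 𝕜 E) : E →ₗ[𝕜] 𝕜) ∈
        Submodule.span 𝕜 (Set.range fun i => (m i : E →ₗ[𝕜] 𝕜)) := by
      refine mem_span_of_iInf_ker_le_ker fun e he => ?_
      simp only [Submodule.mem_iInf, LinearMap.mem_ker, ContinuousLinearMap.coe_coe] at he ⊢
      rw [← hμΛ]
      exact hN _ fun i g => by simp [he i]
    have := Fintype.ofFinite ι
    obtain ⟨a, ha⟩ := (Submodule.mem_span_range_iff_exists_fun 𝕜).1 hmem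
    have ha' : μ k = ∑ i, a i • m i := by
      ext e
      simpa using (LinearMap.congr_fun ha e).symm
    rw [ha']
    simp [hT₀]
  have hexp : ∀ g : G, g = ∑ k, b.repr g k • b k := fun g => (b.sum_repr g).symm
  -- `T₀` need not match `J` on the single `χ j`, only on the combinations `μ k`; hence the detour
  -- through basis coordinates.
  have hfin : Λ T₀ = ∑ j : t, J j (χ j) := by
    calc Λ T₀ = ∑ j : t, ∑ k, b.repr j k * χ j (T₀ (b k)) := by
          rw [hΛsum]
          refine Finset.sum_congr rfl fun j _ => ?_
          conv_lhs => rw [hexp j]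
          simp only [map_sum, map_smul, smul_eq_mul]
      _ = ∑ k, μ k (T₀ (b k)) := by
          rw [Finset.sum_comm]; simp [μ]
      _ = ∑ k, ∑ j : t, b.repr j k * J (b k) (χ j) := by
          simp_rw [hμ]; simp [μ]
      _ = ∑ j : t, J j (χ j) := by
          rw [Finset.sum_comm]
          refine Finset.sum_congr rfl fun j _ => ?_
          conv_rhs => rw [hexp j]
          simp only [map_sum, map_smul, sum_apply, smul_apply, smul_eq_mul]
  rw [hfin]
  refine (norm_sum_le _ _).trans (le_trans (Finset.sum_le_sum fun j _ => ?_) hχle)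
  have h1 : ‖J j‖ ≤ 1 := (hJ j).trans (ht j j.2)
  simpa using (J j).le_of_opNorm_le h1 (χ j)

/-- **Helly's lemma**, without norm control. -/
theorem exists_interpolating_vector (z : StrongDual 𝕜 (StrongDual 𝕜 E)) (m : ι → StrongDual 𝕜 E) :
    ∃ e : E, ∀ i, m i e = z (m i) := by
  classical
  have := Fintype.ofFinite ι
  let Φ : E →ₗ[𝕜] (ι → 𝕜) := LinearMap.pi fun i => (m i : E →ₗ[𝕜] 𝕜)
  have : (fun i => z (m i)) ∈ LinearMap.range Φ := by
    by_contra hnot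
    -- A functional on `𝕜^ι` that vanishes on the range of `Φ` is a linear relation among the `m i`,
    -- and `z` respects such relations.
    obtain ⟨f, hf, hfr⟩ := Submodule.exists_le_ker_of_notMem hnot
    have hfs : ∀ w : ι → 𝕜, f w = ∑ i, w i * f (Pi.single i 1) := fun w => by
      conv_lhs => rw [pi_eq_sum_univ' w]
      simp
    have h0 : ∑ i, f (Pi.single i 1) • m i = 0 := by
      ext e
      have h := hfr (LinearMap.mem_range_self Φ e)
      rw [LinearMap.mem_ker, hfs] at h
      simpa [Φ, mul_comm] using h
    apply hf
    rw [hfs]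
    have := congrArg z h0
    simpa [mul_comm] using this
  obtain ⟨e, he⟩ := this
  exact ⟨e, fun i => congrFun he i⟩

/-- A weak form of the **principle of local reflexivity**: an operator `J : G → E**` on a
finite-dimensional space can be replaced by an operator `T : G → E` with the same action on
finitely many elements of `E*`, at the cost of an arbitrarily small increase of the norm. -/
theorem exists_operator_interpolating (J : G →ₗ[𝕜] StrongDual 𝕜 (StrongDual 𝕜 E))
    (hJ : ∀ g, ‖J g‖ ≤ ‖g‖)
    (m : ι → StrongDual 𝕜 E) {ε : ℝ} (hε : 0 < ε) :
    ∃ T : G →L[𝕜] E, ‖T‖ ≤ 1 + ε ∧ ∀ i g, m i (T g) = J g (m i) := by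
  let b := Module.finBasis 𝕜 G
  choose e he using fun k => exists_interpolating_vector (J (b k)) m
  let T₀ : G →L[𝕜] E := (b.constr 𝕜 e).toContinuousLinearMap
  have hT₀ : ∀ i g, m i (T₀ g) = J g (m i) := fun i g => by
    have hJg : J g = ∑ k, b.repr g k • J (b k) := by
      conv_lhs => rw [← b.sum_repr g]
      simp only [map_sum, map_smul]
    simp [T₀, Module.Basis.constr_apply_fintype, he, hJg]
  let N : Submodule 𝕜 (G →L[𝕜] E) :=
    { carrier := {T | ∀ i g, m i (T g) = 0}
      zero_mem' := by simp
      add_mem' := fun {S T} hS hT i g => by simp [hS i g, hT i g]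
      smul_mem' := fun c T hT i g => by simp [hT i g] }
  have : IsClosed (N : Set (G →L[𝕜] E)) := by
    have : (N : Set (G →L[𝕜] E)) = ⋂ i, ⋂ g, {T | m i (T g) = 0} := by
      ext T; simp [N]
    rw [this]
    exact isClosed_iInter fun i => isClosed_iInter fun g =>
      isClosed_eq (by fun_prop) continuous_const
  -- The distance from `T₀` to `N` is the value at `T₀` of a functional of norm at most `1` that
  -- vanishes on `N`. Any representative of the class of `T₀` still interpolates.
  have hq : ‖(Submodule.Quotient.mk T₀ : (G →L[𝕜] E) ⧸ N)‖ ≤ 1 := by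
    obtain ⟨ψ, hψ, hψq⟩ := exists_dual_vector'' 𝕜 (Submodule.Quotient.mk T₀ : (G →L[𝕜] E) ⧸ N)
    have hle : ∀ T, ‖ψ (N.mkQL T)‖ ≤ 1 * ‖T‖ := fun T =>
      (ψ.le_of_opNorm_le hψ _).trans (by
        rw [one_mul, one_mul]; exact Submodule.Quotient.norm_mk_le N T)
    have h := norm_apply_le_of_interpolates J hJ m T₀ hT₀ (ψ.comp N.mkQL)
      (ContinuousLinearMap.opNorm_le_bound _ zero_le_one hle) (fun T hT => by
        have : N.mkQL T = 0 := (Submodule.Quotient.mk_eq_zero N).2 hT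
        simp [this])
    have h' : ‖ψ (Submodule.Quotient.mk T₀)‖ ≤ 1 := h
    rw [hψq] at h'
    simpa using h'
  obtain ⟨T, hT, hTn⟩ := Submodule.Quotient.norm_mk_lt
    (Submodule.Quotient.mk T₀ : (G →L[𝕜] E) ⧸ N) hε
  refine ⟨T, by linarith, fun i g => ?_⟩
  have : T - T₀ ∈ N := (Submodule.Quotient.eq N).1 hT
  have h := this i g
  rw [sub_apply, map_sub, sub_eq_zero] at h
  rw [h, hT₀]

end LocalReflexivity

/-! ### Lipschitz maps and their pairing with tensors -/

theorem lipConst_le {X Y : Type*} [PseudoMetricSpace X] [PseudoMetricSpace Y] {f : X → Y} {C : ℝ}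
    (hC : 0 ≤ C) (h : ∀ x y, dist (f x) (f y) ≤ C * dist x y) : lipConst f ≤ C :=
  csInf_le ⟨0, fun _ h => h.1⟩ ⟨hC, h⟩

section Lip

variable {𝕜 : Type} [RCLike 𝕜] {X Y : PointedMetricSpace.{u}}
variable {E F : Type v} [NormedAddCommGroup E] [NormedSpace 𝕜 E]
  [NormedAddCommGroup F] [NormedSpace 𝕜 F]

theorem LipTensor.map_apply (h : LipMap X Y) (T : E →L[𝕜] F) (u : LipTensor 𝕜 X E)
    (f : Lip0 𝕜 Y (StrongDual 𝕜 F)) :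
    (LipTensor.map h T u).1 f = u.1 (Lip0.comp (dualOp T) h f) := rfl

theorem Lip0.apply_eq_deltaTensor (f : Lip0 𝕜 X (StrongDual 𝕜 E)) (x : X) (e : E) :
    f.1 x e = deltaTensor x X.base e f := by
  simp [deltaTensor, f.2.1]

theorem Lip0.toBidual_eq_comp (f : Lip0 𝕜 X E) (S : E →L[𝕜] StrongDual 𝕜 (StrongDual 𝕜 E))
    (hS : ∀ e, S e = NormedSpace.inclusionInDoubleDual 𝕜 E e) :
    Lip0.toBidual f = Lip0.comp (F := StrongDual 𝕜 (StrongDual 𝕜 E)) S (LipMap.id X) f := by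
  ext x : 2
  exact (hS _).symm

/-- The tensors in `X ⊠ E` separate the points of `Lip_0(X, E*)`. -/
theorem Lip0.ext_of_tensor {f g : Lip0 𝕜 X (StrongDual 𝕜 E)}
    (h : ∀ u : LipTensor 𝕜 X E, u.1 f = u.1 g) : f = g := by
  ext x e
  rw [Lip0.apply_eq_deltaTensor f, Lip0.apply_eq_deltaTensor g]
  exact h (LipTensor.delta x X.base e)

/-- Every functional on `X ⊠ E` which is bounded on the elementary tensors by a multiple of
`d(x,y)‖e‖` is given by a Lipschitz map `X → E*`. -/
theorem exists_lip0_of_functional (φ : LipTensor 𝕜 X E →ₗ[𝕜] 𝕜) {C : ℝ} (hC : 0 ≤ C)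
    (hφ : ∀ x y e, ‖φ (LipTensor.delta x y e)‖ ≤ C * (dist x y * ‖e‖)) :
    ∃ f : Lip0 𝕜 X (StrongDual 𝕜 E), ∀ u : LipTensor 𝕜 X E, φ u = u.1 f := by
  have hadd : ∀ (x y : X) (e e' : E), (LipTensor.delta x y (e + e') : LipTensor 𝕜 X E)
      = LipTensor.delta x y e + LipTensor.delta x y e' := fun x y e e' =>
    Subtype.ext (by ext f; simp [LipTensor.delta, deltaTensor]; ring)
  have hsmul : ∀ (x y : X) (c : 𝕜) (e : E), (LipTensor.delta x y (c • e) : LipTensor 𝕜 X E)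
      = c • LipTensor.delta x y e := fun x y c e =>
    Subtype.ext (by ext f; simp [LipTensor.delta, deltaTensor])
  have hsub : ∀ (x y : X) (e : E), (LipTensor.delta x y e : LipTensor 𝕜 X E)
      = LipTensor.delta x X.base e - LipTensor.delta y X.base e := fun x y e =>
    Subtype.ext (by ext f; simp [LipTensor.delta, deltaTensor])
  -- Normalising at the base point gives `f(x) = φ(δ_(x,0) ⊠ ·)`; `hsub` then turns the bound on
  -- `δ_(x,y) ⊠ e` into the Lipschitz estimate.
  let f : X → StrongDual 𝕜 E := fun x => LinearMap.mkContinuous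
    { toFun := fun e => φ (LipTensor.delta x X.base e)
      map_add' := fun e e' => by rw [hadd, map_add]
      map_smul' := fun c e => by rw [hsmul, map_smul]; rfl }
    (C * dist x X.base) (fun e => (hφ x X.base e).trans_eq (mul_assoc _ _ _).symm)
  have hf : ∀ x y e, (f x - f y) e = φ (LipTensor.delta x y e) := fun x y e => by
    exact (map_sub φ _ _).symm.trans (congrArg φ (hsub x y e).symm)
  have hf0 : f X.base = 0 := by
    ext e
    have h := hφ X.base X.base e
    rw [dist_self, zero_mul, mul_zero, norm_le_zero_iff] at h
    exact h
  have hfL : ∀ x y, dist (f x) (f y) ≤ C * dist x y := fun x y => by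
    rw [dist_eq_norm]
    refine ContinuousLinearMap.opNorm_le_bound _ (by positivity) fun e => ?_
    rw [hf, mul_assoc]
    exact hφ x y e
  let f' : Lip0 𝕜 X (StrongDual 𝕜 E) :=
    ⟨f, hf0, ⟨C, hC⟩, LipschitzWith.of_dist_le_mul hfL⟩
  refine ⟨f', ?_⟩
  rintro ⟨u, hu⟩
  induction hu using Submodule.span_induction with
  | mem u hu =>
    obtain ⟨x, y, e, rfl⟩ := hu
    exact (hf x y e).symm
  | zero => exact map_zero φ
  | add a b ha hb iha ihb =>
    exact (map_add φ ⟨a, ha⟩ ⟨b, hb⟩).trans (congrArg₂ (· + ·) iha ihb)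
  | smul c a ha iha =>
    exact (map_smul φ c ⟨a, ha⟩).trans (congrArg (c • ·) iha)

/-- Adjointness along the factorisation `ι = S* ∘ J`. With `S = Q_L` and `h` an inclusion, it passes
between `f` and its finite pieces. -/
theorem LipTensor.map_apply_toBidual_comp {G : Type v} [NormedAddCommGroup G] [NormedSpace 𝕜 G]
    (h : LipMap Y X) (S : E →L[𝕜] F) (ι : G →L[𝕜] StrongDual 𝕜 E) (J : G →L[𝕜] StrongDual 𝕜 F)
    (hJ : ∀ g e, J g (S e) = ι g e) (f : Lip0 𝕜 X E) (u : LipTensor 𝕜 Y G) :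
    (LipTensor.map (LipMap.id Y) J u).1 (Lip0.toBidual (Lip0.comp S h f)) =
      (LipTensor.map h ι u).1 (Lip0.toBidual f) := by
  rw [LipTensor.map_apply, LipTensor.map_apply]
  congr 1
  ext y g
  exact hJ g _

/-- A tensor over `Y` sees `ι g` only through its values at the functionals `f(h(y))`, so any `T`
with the same values can replace `ι`. -/
theorem LipTensor.map_apply_toBidual {G : Type v} [NormedAddCommGroup G] [NormedSpace 𝕜 G]
    (h : LipMap Y X)
    (ι : G →L[𝕜] StrongDual 𝕜 (StrongDual 𝕜 E)) (T : G →L[𝕜] E) (f : Lip0 𝕜 X (StrongDual 𝕜 E))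
    (hT : ∀ y g, f.1 (h.toFun y) (T g) = ι g (f.1 (h.toFun y))) (u : LipTensor 𝕜 Y G) :
    (LipTensor.map h ι u).1 (Lip0.toBidual f) = (LipTensor.map h T u).1 f := by
  rw [LipTensor.map_apply, LipTensor.map_apply]
  congr 1
  ext y g
  exact (hT y g).symm

end Lip

/-! ### Norm bounds, and the finite case -/

section Generic

variable {𝕜 : Type} [RCLike 𝕜]

theorem GenericLipCrossNorm.norm_map_le (α : GenericLipCrossNorm.{u, v} 𝕜)
    {X Y : PointedMetricSpace.{u}} {E F : Type v}
    [NormedAddCommGroup E] [NormedSpace 𝕜 E] [CompleteSpace E]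
    [NormedAddCommGroup F] [NormedSpace 𝕜 F] [CompleteSpace F]
    (h : LipMap X Y) (hh : ∀ x y, dist (h.toFun x) (h.toFun y) ≤ dist x y)
    (T : E →L[𝕜] F) {C : ℝ} (hC : 0 ≤ C) (hT : ∀ e, ‖T e‖ ≤ C * ‖e‖) (u : LipTensor 𝕜 X E) :
    α.norm Y F (LipTensor.map h T u) ≤ C * α.norm X E u := by
  have hT : ‖T‖ ≤ C := T.opNorm_le_bound hC hT
  refine (α.metric_mapping X Y E F h T u).trans ?_
  have h1 : lipConst h.toFun ≤ 1 := lipConst_le zero_le_one (by simpa using hh)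
  refine mul_le_mul_of_nonneg_right ?_ (apply_nonneg _ u)
  calc lipConst h.toFun * ‖T‖ ≤ 1 * ‖T‖ := by gcongr
    _ ≤ C := by rwa [one_mul]

/-- `‖f‖_A ≤ C`, including membership of `f` in `A(X, E)`. -/
def GenericLipIdeal.Bounded (A : GenericLipIdeal.{u, v} 𝕜) {X : PointedMetricSpace.{u}} {E : Type v}
    [NormedAddCommGroup E] [NormedSpace 𝕜 E] [CompleteSpace E] (f : Lip0 𝕜 X E) (C : ℝ) : Prop :=
  ∃ hf : f ∈ A.carrier X E, A.norm X E ⟨f, hf⟩ ≤ C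

/-- The functional `u ↦ u(κ_E ∘ f)` on `X ⊠_α E*` is bounded by `C`. -/
def GenericLipCrossNorm.BidualBounded (α : GenericLipCrossNorm.{u, v} 𝕜)
    {X : PointedMetricSpace.{u}} {E : Type v}
    [NormedAddCommGroup E] [NormedSpace 𝕜 E] [CompleteSpace E] (f : Lip0 𝕜 X E) (C : ℝ) : Prop :=
  ∀ u : LipTensor 𝕜 X (StrongDual 𝕜 E),
    ‖u.1 (Lip0.toBidual f)‖ ≤ C * α.norm X (StrongDual 𝕜 E) u

variable {A : GenericLipIdeal.{u, v} 𝕜} {α : GenericLipCrossNorm.{u, v} 𝕜}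

theorem GenericLipIdeal.extNorm_le_iff {X : PointedMetricSpace.{u}} {E : Type v}
    [NormedAddCommGroup E] [NormedSpace 𝕜 E] [CompleteSpace E] {f : Lip0 𝕜 X E} {C : ℝ}
    (hC : 0 ≤ C) : A.extNorm f ≤ ENNReal.ofReal C ↔ A.Bounded f C := by
  unfold extNorm Bounded
  split_ifs with hf
  · rw [ENNReal.ofReal_le_ofReal_iff hC]
    exact ⟨fun h => ⟨hf, h⟩, fun h => h.2⟩
  · simp [hf]

theorem GenericLipIdeal.IsMaximal.bounded_iff (hA : A.IsMaximal) {X : PointedMetricSpace.{u}}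
    {E : Type v} [NormedAddCommGroup E] [NormedSpace 𝕜 E] [CompleteSpace E] {f : Lip0 𝕜 X E}
    {C : ℝ} (hC : 0 ≤ C) : A.Bounded f C ↔ A.maxNorm f ≤ ENNReal.ofReal C := by
  obtain ⟨h1, h2⟩ := hA X E
  constructor
  · rintro ⟨hf, hfC⟩
    rw [← h2 ⟨f, hf⟩]
    exact ENNReal.ofReal_le_ofReal hfC
  · intro h
    have hf : f ∈ A.carrier X E := (h1 f).2 (h.trans_lt ENNReal.ofReal_lt_top)
    refine ⟨hf, ?_⟩
    rwa [← h2 ⟨f, hf⟩, ENNReal.ofReal_le_ofReal_iff hC] at h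

theorem GenericLipIdeal.Bounded.comp {X : PointedMetricSpace.{u}} {E F : Type v}
    [NormedAddCommGroup E] [NormedSpace 𝕜 E] [CompleteSpace E]
    [NormedAddCommGroup F] [NormedSpace 𝕜 F] [CompleteSpace F] {f : Lip0 𝕜 X E} {C : ℝ}
    (hf : A.Bounded f C) (S : E →L[𝕜] F) (hS : ∀ e, ‖S e‖ ≤ ‖e‖) :
    A.Bounded (Lip0.comp S (LipMap.id X) f) C := by
  have hS : ‖S‖ ≤ 1 := S.opNorm_le_bound zero_le_one (by simpa using hS)
  obtain ⟨hf, hfC⟩ := hf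
  obtain ⟨hmem, h⟩ := A.ideal X X E F ⟨f, hf⟩ (LipMap.id X) S
  have h1 : lipConst (LipMap.id X).toFun ≤ 1 :=
    lipConst_le zero_le_one fun x y => (one_mul (dist x y)).ge
  have h0 : 0 ≤ A.norm X E ⟨f, hf⟩ := apply_nonneg _ _
  refine ⟨hmem, h.trans ?_⟩
  calc ‖S‖ * A.norm X E ⟨f, hf⟩ * lipConst (LipMap.id X).toFun
      ≤ ‖S‖ * A.norm X E ⟨f, hf⟩ * 1 := by gcongr
    _ ≤ 1 * A.norm X E ⟨f, hf⟩ * 1 := by gcongr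
    _ ≤ C := by simpa using hfC

theorem GenericLipIdeal.Bounded.toBidual {X : PointedMetricSpace.{u}} {E : Type v}
    [NormedAddCommGroup E] [NormedSpace 𝕜 E] [CompleteSpace E] {f : Lip0 𝕜 X E} {C : ℝ}
    (hf : A.Bounded f C) : A.Bounded (Lip0.toBidual f) C := by
  obtain ⟨S, hS⟩ : ∃ S : E →L[𝕜] StrongDual 𝕜 (StrongDual 𝕜 E),
      ∀ e, S e = NormedSpace.inclusionInDoubleDual 𝕜 E e :=
    ⟨NormedSpace.inclusionInDoubleDual 𝕜 E, fun _ => rfl⟩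
  have h := hf.comp (F := StrongDual 𝕜 (StrongDual 𝕜 E)) S
    fun e => (hS e).symm ▸ NormedSpace.double_dual_bound 𝕜 E e
  rw [Lip0.toBidual_eq_comp f S hS]
  exact h

/-- In finite dimensions, `κ_E` has a linear inverse of norm at most `1`. -/
theorem exists_inclusionInDoubleDual_symm (𝕜 : Type*) [RCLike 𝕜] (E : Type*)
    [NormedAddCommGroup E] [NormedSpace 𝕜 E] [FiniteDimensional 𝕜 E] :
    ∃ R : StrongDual 𝕜 (StrongDual 𝕜 E) →L[𝕜] E, (∀ z, ‖R z‖ ≤ ‖z‖) ∧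
      ∀ e, R (NormedSpace.inclusionInDoubleDual 𝕜 E e) = e := by
  let J : E →ₗ[𝕜] StrongDual 𝕜 (StrongDual 𝕜 E) :=
    (NormedSpace.inclusionInDoubleDualLi 𝕜 (E := E)).toLinearMap
  have hJ : Function.Injective J := (NormedSpace.inclusionInDoubleDualLi 𝕜 (E := E)).injective
  have hJs : Function.Surjective J := fun z => by
    -- Helly's lemma on a basis of `E*` yields a preimage of `z`.
    let b := Module.finBasis 𝕜 (StrongDual 𝕜 E)
    obtain ⟨e, he⟩ := exists_interpolating_vector z b
    exact ⟨e, ContinuousLinearMap.coe_injective (b.ext fun i => he i)⟩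
  let e : E ≃ₗ[𝕜] StrongDual 𝕜 (StrongDual 𝕜 E) := LinearEquiv.ofBijective J ⟨hJ, hJs⟩
  have hbd : ∀ z, ‖e.symm z‖ ≤ 1 * ‖z‖ := fun z => by
    obtain ⟨x, rfl⟩ := e.surjective z
    have h : ‖e x‖ = ‖x‖ := (NormedSpace.inclusionInDoubleDualLi 𝕜 (E := E)).norm_map x
    rw [h, one_mul, e.symm_apply_apply]
  let R : StrongDual 𝕜 (StrongDual 𝕜 E) →L[𝕜] E :=
    ⟨e.symm.toLinearMap, AddMonoidHomClass.continuous_of_bound e.symm 1 hbd⟩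
  exact ⟨R, fun z => (hbd z).trans_eq (one_mul _), fun x => e.symm_apply_apply x⟩

/-- For finite `X` and finite-dimensional `E`, association identifies `A(X, E)` with
`(X ⊠_α E*)*`. -/
theorem AreAssociated.bounded_iff_of_finite (hAα : AreAssociated A α) {X : PointedMetricSpace.{u}}
    {E : Type v} [NormedAddCommGroup E] [NormedSpace 𝕜 E] [CompleteSpace E] [Finite X]
    [FiniteDimensional 𝕜 E] {f : Lip0 𝕜 X E} {C : ℝ} (hC : 0 ≤ C) :
    A.Bounded f C ↔ α.BidualBounded f C := by
  -- Association concerns dual-valued maps, so it is applied to `E*` and describes `A(X, E**)`;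
  -- `κ_E` and its contractive inverse transfer bounds to and from `E`.
  obtain ⟨Φ, hΦ⟩ := hAα X (StrongDual 𝕜 E)
  constructor
  · intro h u
    obtain ⟨hf, hfC⟩ := h.toBidual
    let g : A.Space X (StrongDual 𝕜 (StrongDual 𝕜 E)) := ⟨_, hf⟩
    have hg : ‖Φ g‖ ≤ C := (Φ.norm_map g).trans_le hfC
    have h := ContinuousLinearMap.le_of_opNorm_le (Φ g) hg (α.toSpace X (StrongDual 𝕜 E) u)
    have h' := hΦ g u
    rw [h'] at h
    exact h
  · intro h
    let φ : StrongDual 𝕜 (α.Space X (StrongDual 𝕜 E)) := LinearMap.mkContinuous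
      { toFun := fun u : LipTensor 𝕜 X (StrongDual 𝕜 E) => u.1 (Lip0.toBidual f)
        map_add' := fun _ _ => rfl
        map_smul' := fun _ _ => rfl } C h
    have hφ : ‖φ‖ ≤ C := LinearMap.mkContinuous_norm_le _ hC _
    obtain ⟨g, hg⟩ := Φ.surjective φ
    have hgf : g.toLip0 = Lip0.toBidual f := Lip0.ext_of_tensor fun u => by
      rw [← hΦ g u, hg]; rfl
    have hgC : A.Bounded (Lip0.toBidual f) C := by
      rw [← hgf]
      refine ⟨g.2, ?_⟩
      rw [← hg, Φ.norm_map] at hφ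
      exact hφ
    obtain ⟨R, hR, hRκ⟩ := exists_inclusionInDoubleDual_symm 𝕜 E
    have hid : Lip0.comp (E := StrongDual 𝕜 (StrongDual 𝕜 E)) R (LipMap.id X)
        (Lip0.toBidual f) = f := by
      ext x
      exact hRκ (f.1 x)
    rw [← hid]
    exact hgC.comp (E := StrongDual 𝕜 (StrongDual 𝕜 E)) R hR

end Generic

/-! ### Infima, finite-dimensional quotients, duals of completions -/

theorem IsGLB.le_mul {S : Set ℝ} {a C x : ℝ} (h : IsGLB S a) (hC : 0 ≤ C)
    (hx : ∀ r ∈ S, x ≤ C * r) : x ≤ C * a := by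
  -- For `C = 0` division fails, but a set of reals with a greatest lower bound is nonempty, and one
  -- element suffices.
  rcases hC.eq_or_lt with rfl | hC
  · obtain ⟨r, hr⟩ := h.nonempty
    simpa using hx r hr
  · rw [mul_comm, ← div_le_iff₀ hC]
    exact h.2 fun r hr => by
      rw [div_le_iff₀ hC, mul_comm]
      exact hx r hr

/-- A finite-dimensional space `G` of functionals on `E` acts on a finite-dimensional quotient
of `E`, with the same norm bound. -/
theorem exists_quotient_of_finiteDimensional {𝕜 : Type*} [RCLike 𝕜] {E G : Type*}
    [NormedAddCommGroup E] [NormedSpace 𝕜 E] [NormedAddCommGroup G] [NormedSpace 𝕜 G]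
    [FiniteDimensional 𝕜 G] (ι : G →ₗ[𝕜] StrongDual 𝕜 E) (hι : ∀ g, ‖ι g‖ ≤ ‖g‖) :
    ∃ L : Submodule 𝕜 E, ∃ _ : IsClosed (L : Set E), FiniteDimensional 𝕜 (E ⧸ L) ∧
      ∃ J : G →L[𝕜] StrongDual 𝕜 (E ⧸ L), (∀ g, ‖J g‖ ≤ ‖g‖) ∧
        ∀ g e, J g (L.mkQL e) = ι g e := by
  let b := Module.finBasis 𝕜 G
  let Φ : E →ₗ[𝕜] (Fin (Module.finrank 𝕜 G) → 𝕜) :=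
    LinearMap.pi fun k => (ι (b k) : E →ₗ[𝕜] 𝕜)
  let L : Submodule 𝕜 E := LinearMap.ker Φ
  have hL : ∀ e ∈ L, ∀ g : G, ι g e = 0 := fun e he g => by
    have hb : ∀ k, ι (b k) e = 0 := fun k => congrFun he k
    rw [← b.sum_repr g, map_sum]
    simp only [map_smul, sum_apply, smul_apply, hb, smul_zero, Finset.sum_const_zero]
  have hcl : IsClosed (L : Set E) := by
    have : (L : Set E) = ⋂ k, {e | ι (b k) e = 0} := by
      ext e
      simp only [Set.mem_iInter, Set.mem_ofPred_eq]
      exact ⟨fun he k => congrFun he k, fun h => funext h⟩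
    rw [this]
    exact isClosed_iInter fun k => isClosed_eq (by fun_prop) continuous_const
  have hfd : FiniteDimensional 𝕜 (E ⧸ L) := Module.Finite.equiv Φ.quotKerEquivRange.symm
  have hbd : ∀ (g : G) (q : E ⧸ L),
      ‖L.liftQ (ι g : E →ₗ[𝕜] 𝕜) (fun e he => hL e he g) q‖ ≤ ‖g‖ * ‖q‖ := by
    intro g q
    -- The quotient norm is an infimum that need not be attained, hence the slack `δ`.
    have key : ∀ δ > 0, ‖L.liftQ (ι g : E →ₗ[𝕜] 𝕜) (fun e he => hL e he g) q‖
        ≤ ‖g‖ * (‖q‖ + δ) := by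
      intro δ hδ
      obtain ⟨e, rfl, he⟩ := Submodule.Quotient.norm_mk_lt q hδ
      exact ((ι g).le_opNorm e).trans (mul_le_mul (hι g) he.le (norm_nonneg e) (norm_nonneg g))
    have hlim : Tendsto (fun δ : ℝ => ‖g‖ * (‖q‖ + δ)) (𝓝[>] 0) (𝓝 (‖g‖ * ‖q‖)) := by
      have : Continuous fun δ : ℝ => ‖g‖ * (‖q‖ + δ) := by fun_prop
      simpa using (this.tendsto 0).mono_left nhdsWithin_le_nhds
    exact ge_of_tendsto hlim (eventually_nhdsWithin_of_forall key)
  let J : G →ₗ[𝕜] StrongDual 𝕜 (E ⧸ L) :=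
    { toFun := fun g => (L.liftQ (ι g : E →ₗ[𝕜] 𝕜) fun e he => hL e he g).mkContinuous ‖g‖ (hbd g)
      map_add' := fun g g' => by
        ext q
        obtain ⟨e, rfl⟩ := L.mkQ_surjective q
        exact DFunLike.congr_fun (map_add ι g g') e
      map_smul' := fun c g => by
        ext q
        obtain ⟨e, rfl⟩ := L.mkQ_surjective q
        exact DFunLike.congr_fun (map_smul ι c g) e }
  have hJ : ∀ g, ‖J g‖ ≤ ‖g‖ := fun g =>
    LinearMap.mkContinuous_norm_le _ (norm_nonneg g) (hbd g)
  have hJc : Continuous J :=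
    AddMonoidHomClass.continuous_of_bound J 1 fun g => (hJ g).trans_eq (one_mul _).symm
  exact ⟨L, hcl, hfd, ⟨J, hJc⟩, hJ, fun g e => rfl⟩

/-- A norm-preserving pairing of normed spaces `N` and `S` yields an isometric embedding of `N` into
the dual of the completion of `S`. -/
theorem exists_isometry_dual_completion {𝕜 : Type*} [RCLike 𝕜] {N S : Type*}
    [NormedAddCommGroup N] [NormedSpace 𝕜 N] [NormedAddCommGroup S] [NormedSpace 𝕜 S]
    (β : N →ₗ[𝕜] S →ₗ[𝕜] 𝕜) (hβ : ∀ f s, ‖β f s‖ ≤ ‖f‖ * ‖s‖)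
    (hβ' : ∀ f C, 0 ≤ C → (∀ s, ‖β f s‖ ≤ C * ‖s‖) → ‖f‖ ≤ C) :
    ∃ Ψ : N →ₗᵢ[𝕜] StrongDual 𝕜 (UniformSpace.Completion S),
      ∀ f (s : S), Ψ f (s : UniformSpace.Completion S) = β f s := by
  let ι : S →ₗ[𝕜] UniformSpace.Completion S :=
    (UniformSpace.Completion.toComplL (𝕜 := 𝕜) (E := S)).toLinearMap
  have hι : DenseRange ι := UniformSpace.Completion.denseRange_coe
  have hn : ∀ s, ‖ι s‖ = ‖s‖ := UniformSpace.Completion.norm_coe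
  have hbd : ∀ f s, ‖β f s‖ ≤ ‖f‖ * ‖ι s‖ := fun f s => by rw [hn]; exact hβ f s
  have heq : ∀ f s, (β f).extendOfNorm ι (ι s) = β f s := fun f s =>
    LinearMap.extendOfNorm_eq hι ⟨_, hbd f⟩ s
  have hext : ∀ a b : StrongDual 𝕜 (UniformSpace.Completion S), (∀ s, a (ι s) = b (ι s)) → a = b :=
    fun a b h => ContinuousLinearMap.coeFn_injective
      (hι.equalizer a.continuous b.continuous (funext h))
  refine ⟨{ toFun := fun f => (β f).extendOfNorm ι, map_add' := fun f g => ?_,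
            map_smul' := fun c f => ?_, norm_map' := fun f => ?_ }, heq⟩
  · exact hext _ _ fun s => (heq (f + g) s).trans (by simp [heq])
  · exact hext _ _ fun s => (heq (c • f) s).trans (by simp [heq])
  · refine le_antisymm (LinearMap.opNorm_extendOfNorm_le hι (norm_nonneg f) (hbd f))
      (hβ' f _ (norm_nonneg _) fun s => ?_)
    have h := ((β f).extendOfNorm ι).le_opNorm (ι s)
    rwa [heq, hn] at h

/-! ### The norm criteria on arbitrary spaces -/

section Generic

variable {𝕜 : Type} [RCLike 𝕜]
variable {A : GenericLipIdeal.{u, v} 𝕜} {α : GenericLipCrossNorm.{u, v} 𝕜}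
variable {X : PointedMetricSpace.{u}} {E : Type v} [NormedAddCommGroup E] [NormedSpace 𝕜 E]
  [CompleteSpace E]

instance (Y : Finset X) (hY : X.base ∈ Y) : Finite (X.sub Y hY) :=
  inferInstanceAs (Finite {x : X // x ∈ Y})

/-- To bound a functional on `X ⊠_α E`, it suffices to bound it on the images of the spaces
`Y ⊠_α G` for finite `Y ⊆ X` and finite-dimensional `G`. -/
theorem GenericLipCrossNorm.IsFinitelyGenerated.bound (hα : α.IsFinitelyGenerated)
    (φ : LipTensor 𝕜 X E → 𝕜) {C : ℝ} (hC : 0 ≤ C)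
    (h : ∀ (Y : Finset X) (hY : X.base ∈ Y) (G : Type v) [NormedAddCommGroup G] [NormedSpace 𝕜 G]
      [CompleteSpace G] [FiniteDimensional 𝕜 G] (ι : G →L[𝕜] E) (_ : ∀ g, ‖ι g‖ ≤ ‖g‖)
      (u : LipTensor 𝕜 (X.sub Y hY) G),
      ‖φ (LipTensor.map (X.incl Y hY) ι u)‖ ≤ C * α.norm (X.sub Y hY) G u)
    (u : LipTensor 𝕜 X E) : ‖φ u‖ ≤ C * α.norm X E u := by
  refine (hα X E u).le_mul hC ?_
  rintro _ ⟨Y, hY, G, hG, u₀, rfl, rfl⟩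
  have := FiniteDimensional.complete 𝕜 G
  exact h Y hY G G.subtypeL (fun g => le_rfl) u₀

theorem GenericLipIdeal.maxNorm_le_iff {f : Lip0 𝕜 X E} {c : ℝ≥0∞} :
    A.maxNorm f ≤ c ↔ ∀ (Y : Finset X) (hY : X.base ∈ Y) (L : Submodule 𝕜 E)
      (_ : IsClosed (L : Set E)) (_ : FiniteDimensional 𝕜 (E ⧸ L)),
      A.extNorm (Lip0.comp L.mkQL (X.incl Y hY) f) ≤ c := by
  simp only [maxNorm, iSup_le_iff]

set_option maxHeartbeats 2000000 in
/-- `‖f‖_A ≤ C` if and only if the functional of `κ_E ∘ f` on `X ⊠_α E*` is bounded by `C`. -/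
theorem bounded_iff_bidualBounded (hA : A.IsMaximal) (hα : α.IsFinitelyGenerated)
    (hAα : AreAssociated A α) {f : Lip0 𝕜 X E} {C : ℝ} (hC : 0 ≤ C) :
    A.Bounded f C ↔ α.BidualBounded f C := by
  rw [hA.bounded_iff hC, GenericLipIdeal.maxNorm_le_iff]
  constructor
  · intro h u
    refine hα.bound (fun u => u.1 (Lip0.toBidual f)) hC (fun Y hY G _ _ _ _ ι hι u₀ => ?_) u
    obtain ⟨L, hL, hfd, J, hJ, hJe⟩ := exists_quotient_of_finiteDimensional ι.toLinearMap hι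
    have h0 := (hAα.bounded_iff_of_finite hC).1
      ((GenericLipIdeal.extNorm_le_iff hC).1 (h Y hY L hL hfd))
    rw [← LipTensor.map_apply_toBidual_comp (X.incl Y hY) L.mkQL ι J hJe f u₀]
    have h3 := α.norm_map_le (LipMap.id (X.sub Y hY)) (fun _ _ => le_rfl) J zero_le_one
      (by simpa using hJ) u₀
    rw [one_mul] at h3
    exact (h0 _).trans (mul_le_mul_of_nonneg_left h3 hC)
  · intro h Y hY L hL hfd
    refine (GenericLipIdeal.extNorm_le_iff hC).2 ((hAα.bounded_iff_of_finite hC).2 fun w => ?_)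
    have hT : ∀ φ : StrongDual 𝕜 (E ⧸ L), ‖dualOp L.mkQL φ‖ ≤ 1 * ‖φ‖ := fun φ => by
      rw [one_mul]
      refine ContinuousLinearMap.opNorm_le_bound _ (norm_nonneg φ) fun e => ?_
      exact (φ.le_opNorm _).trans
        (mul_le_mul_of_nonneg_left (Submodule.Quotient.norm_mk_le L e) (norm_nonneg φ))
    -- By adjointness, this tensor pairs with `κ_E ∘ f` as `w` pairs with the bidual version of `Q_L
    -- ∘ f|_Y`.
    have h1 := h (LipTensor.map (X.incl Y hY) (dualOp L.mkQL) w)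
    have h3 := α.norm_map_le (X.incl Y hY) (fun _ _ => le_rfl) (dualOp L.mkQL) zero_le_one hT w
    rw [one_mul] at h3
    exact h1.trans (mul_le_mul_of_nonneg_left h3 hC)

set_option maxHeartbeats 2000000 in
/-- For maps into a dual space, the functional of `κ ∘ f` on `X ⊠_α E**` is bounded by `C` if and
only if the functional of `f` on `X ⊠_α E` is. -/
theorem bidualBounded_iff_of_dual (hα : α.IsFinitelyGenerated)
    {f : Lip0 𝕜 X (StrongDual 𝕜 E)} {C : ℝ} (hC : 0 ≤ C) :
    α.BidualBounded f C ↔ ∀ u : LipTensor 𝕜 X E, ‖u.1 f‖ ≤ C * α.norm X E u := by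
  constructor
  · intro h u
    obtain ⟨S, hS⟩ : ∃ S : E →L[𝕜] StrongDual 𝕜 (StrongDual 𝕜 E),
        ∀ e, S e = NormedSpace.inclusionInDoubleDual 𝕜 E e :=
      ⟨NormedSpace.inclusionInDoubleDual 𝕜 E, fun _ => rfl⟩
    have h1 := h (LipTensor.map (F := StrongDual 𝕜 (StrongDual 𝕜 E)) (LipMap.id X) S u)
    have h2 : (LipTensor.map (F := StrongDual 𝕜 (StrongDual 𝕜 E)) (LipMap.id X) S u).1
        (Lip0.toBidual f) = u.1 f := by
      rw [LipTensor.map_apply]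
      congr 1
      ext x e
      exact DFunLike.congr_fun (hS e) (f.1 x)
    rw [h2] at h1
    have h3 := α.norm_map_le (F := StrongDual 𝕜 (StrongDual 𝕜 E)) (LipMap.id X)
      (fun _ _ => le_rfl) S zero_le_one
      (fun e => by rw [one_mul, hS]; exact NormedSpace.double_dual_bound 𝕜 E e) u
    rw [one_mul] at h3
    exact h1.trans (mul_le_mul_of_nonneg_left h3 hC)
  · intro h u
    refine hα.bound (fun u => u.1 (Lip0.toBidual f)) hC (fun Y hY G _ _ _ _ ι hι u₀ => ?_) u
    have key : ∀ ε > 0, ‖(LipTensor.map (X.incl Y hY) ι u₀).1 (Lip0.toBidual f)‖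
        ≤ C * ((1 + ε) * α.norm (X.sub Y hY) G u₀) := by
      intro ε hε
      -- Local reflexivity is used for the functionals `f(y)` with `y ∈ Y`, finitely many since `Y`
      -- is finite.
      obtain ⟨T, hT, hTm⟩ := exists_operator_interpolating ι.toLinearMap hι
        (fun y : X.sub Y hY => f.1 y.1) hε
      rw [LipTensor.map_apply_toBidual (X.incl Y hY) ι T f hTm u₀]
      exact (h _).trans (mul_le_mul_of_nonneg_left (α.norm_map_le _ (fun _ _ => le_rfl) T
        (by positivity) (fun e => T.le_of_opNorm_le hT e) u₀) hC)
    have hlim : Tendsto (fun ε : ℝ => C * ((1 + ε) * α.norm (X.sub Y hY) G u₀)) (𝓝[>] 0)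
        (𝓝 (C * α.norm (X.sub Y hY) G u₀)) := by
      have : Continuous fun ε : ℝ => C * ((1 + ε) * α.norm (X.sub Y hY) G u₀) := by fun_prop
      simpa using (this.tendsto 0).mono_left nhdsWithin_le_nhds
    exact ge_of_tendsto hlim (eventually_nhdsWithin_of_forall key)

end Generic

/-! ### From bounds to isometries onto duals -/

section Generic

variable {𝕜 : Type} [RCLike 𝕜]
variable {A : GenericLipIdeal.{u, v} 𝕜} {α : GenericLipCrossNorm.{u, v} 𝕜}
variable {X : PointedMetricSpace.{u}} {E D : Type v} [NormedAddCommGroup E] [NormedSpace 𝕜 E]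
  [CompleteSpace E] [NormedAddCommGroup D] [NormedSpace 𝕜 D] [CompleteSpace D]

/-- If `‖f‖_A ≤ C` holds exactly when the functional `β f` on `X ⊠_α D` is bounded by `C`, then
`β` embeds `A(X, E)` isometrically into `(X ⊠̂_α D)*`, and the elements of `A(X, E)` are those `f`
for which `β f` is bounded. -/
theorem exists_isometry_of_bounded_iff (β : Lip0 𝕜 X E →ₗ[𝕜] LipTensor 𝕜 X D →ₗ[𝕜] 𝕜)
    (hβ : ∀ f C, 0 ≤ C → (A.Bounded f C ↔ ∀ u, ‖β f u‖ ≤ C * α.norm X D u)) :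
    ∃ Ψ : A.Space X E →ₗᵢ[𝕜] StrongDual 𝕜 (UniformSpace.Completion (α.Space X D)),
      (∀ (f : A.Space X E) (u : LipTensor 𝕜 X D),
        Ψ f (α.toSpace X D u : UniformSpace.Completion (α.Space X D)) = β f.toLip0 u) ∧
      ∀ f : Lip0 𝕜 X E, f ∈ A.carrier X E ↔
        ∃ φ : StrongDual 𝕜 (UniformSpace.Completion (α.Space X D)), ∀ u : LipTensor 𝕜 X D,
          φ (α.toSpace X D u : UniformSpace.Completion (α.Space X D)) = β f u := by
  let β' : A.Space X E →ₗ[𝕜] α.Space X D →ₗ[𝕜] 𝕜 := β.comp (A.carrier X E).subtype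
  -- The criterion with `C = ‖f‖` bounds the pairing; read backwards, it shows that no smaller bound
  -- holds.
  obtain ⟨Ψ, hΨ⟩ := exists_isometry_dual_completion β'
    (fun f => (hβ f.toLip0 ‖f‖ (norm_nonneg f)).1 ⟨f.2, le_rfl⟩)
    (fun f C hC h => ((hβ f.toLip0 C hC).2 h).2)
  refine ⟨Ψ, fun f u => hΨ f u, fun f => ⟨fun hf => ?_, ?_⟩⟩
  · let f' : A.Space X E := ⟨f, hf⟩
    exact ⟨Ψ f', fun u => hΨ f' u⟩
  · rintro ⟨φ, hφ⟩
    refine ((hβ f ‖φ‖ (norm_nonneg φ)).2 fun u => ?_).1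
    rw [← hφ u]
    refine (φ.le_opNorm _).trans_eq ?_
    rw [UniformSpace.Completion.norm_coe]
    rfl

/-- Every continuous functional on `X ⊠̂_α E` is given by a Lipschitz map `X → E*`. -/
theorem exists_lip0_of_dual_completion
    (φ : StrongDual 𝕜 (UniformSpace.Completion (α.Space X E))) :
    ∃ f : Lip0 𝕜 X (StrongDual 𝕜 E), ∀ u : LipTensor 𝕜 X E,
      φ (α.toSpace X E u : UniformSpace.Completion (α.Space X E)) = u.1 f := by
  let φ₀ : LipTensor 𝕜 X E →ₗ[𝕜] 𝕜 :=
    (φ.comp (UniformSpace.Completion.toComplL (𝕜 := 𝕜) (E := α.Space X E))).toLinearMap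
  refine exists_lip0_of_functional φ₀ (norm_nonneg φ) fun x y e => ?_
  refine (φ.le_opNorm _).trans_eq ?_
  -- The cross-norm identity gives the Lipschitz bound `‖φ‖`.
  rw [← α.cross X E x y e]
  exact congrArg (‖φ‖ * ·) (UniformSpace.Completion.norm_coe _)

/-- If moreover every continuous functional on `X ⊠̂_α D` is of the form `β f`, then `β` identifies
`A(X, E)` with `(X ⊠̂_α D)*`. -/
theorem exists_isometryEquiv_of_bounded_iff (β : Lip0 𝕜 X E →ₗ[𝕜] LipTensor 𝕜 X D →ₗ[𝕜] 𝕜)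
    (hβ : ∀ f C, 0 ≤ C → (A.Bounded f C ↔ ∀ u, ‖β f u‖ ≤ C * α.norm X D u))
    (hβs : ∀ φ : StrongDual 𝕜 (UniformSpace.Completion (α.Space X D)), ∃ f, ∀ u : LipTensor 𝕜 X D,
      φ (α.toSpace X D u : UniformSpace.Completion (α.Space X D)) = β f u) :
    ∃ Φ : A.Space X E ≃ₗᵢ[𝕜] StrongDual 𝕜 (UniformSpace.Completion (α.Space X D)),
      ∀ (f : A.Space X E) (u : LipTensor 𝕜 X D),
        Φ f (α.toSpace X D u : UniformSpace.Completion (α.Space X D)) = β f.toLip0 u := by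
  obtain ⟨Ψ, hΨ, hmem⟩ := exists_isometry_of_bounded_iff β hβ
  have hsurj : Function.Surjective Ψ := fun φ => by
    obtain ⟨f, hf⟩ := hβs φ
    let f' : A.Space X E := ⟨f, (hmem f).2 ⟨φ, hf⟩⟩
    exact ⟨f', ContinuousLinearMap.coeFn_injective
      (UniformSpace.Completion.denseRange_coe.equalizer (Ψ f').continuous φ.continuous
        (funext fun u => (hΨ f' u).trans (hf u).symm))⟩
  exact ⟨LinearIsometryEquiv.ofSurjective Ψ hsurj, hΨ⟩

/-- For maps into a dual space, `‖f‖_A ≤ C` if and only if the functional of `f` on `X ⊠_α E` is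
bounded by `C`. -/
theorem bounded_iff_of_dual (hA : A.IsMaximal) (hα : α.IsFinitelyGenerated)
    (hAα : AreAssociated A α) (f : Lip0 𝕜 X (StrongDual 𝕜 E)) (C : ℝ) (hC : 0 ≤ C) :
    A.Bounded f C ↔ ∀ u : LipTensor 𝕜 X E, ‖u.1 f‖ ≤ C * α.norm X E u := by
  have h1 : A.Bounded f C ↔ α.BidualBounded f C :=
    bounded_iff_bidualBounded (E := StrongDual 𝕜 E) (f := f) hA hα hAα hC
  have h2 : α.BidualBounded f C ↔ ∀ u : LipTensor 𝕜 X E, ‖u.1 f‖ ≤ C * α.norm X E u :=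
    bidualBounded_iff_of_dual hα hC
  rw [h1]
  exact h2

end Generic

theorem mainTheorem2 {𝕜 : Type} [RCLike 𝕜]
    (A : GenericLipIdeal.{u, v} 𝕜) (α : GenericLipCrossNorm.{u, v} 𝕜)
    (hA : A.IsMaximal) (hα : α.IsFinitelyGenerated) (hAα : AreAssociated A α)
    (X : PointedMetricSpace.{u}) (E : Type v)
    [NormedAddCommGroup E] [NormedSpace 𝕜 E] [CompleteSpace E] :
    (∃ Φ : A.Space X (StrongDual 𝕜 E) ≃ₗᵢ[𝕜]
          StrongDual 𝕜 (UniformSpace.Completion (α.Space X E)),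
        ∀ (f : A.Space X (StrongDual 𝕜 E)) (u : LipTensor 𝕜 X E),
          Φ f (α.toSpace X E u : UniformSpace.Completion (α.Space X E)) = u.1 f.toLip0) ∧
    (∃ Ψ : A.Space X E →ₗᵢ[𝕜]
          StrongDual 𝕜 (UniformSpace.Completion (α.Space X (StrongDual 𝕜 E))),
        (∀ (f : A.Space X E) (u : LipTensor 𝕜 X (StrongDual 𝕜 E)),
          Ψ f (α.toSpace X (StrongDual 𝕜 E) u :
              UniformSpace.Completion (α.Space X (StrongDual 𝕜 E)))
            = u.1 (Lip0.toBidual f.toLip0)) ∧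
        ∀ f : Lip0 𝕜 X E,
          f ∈ A.carrier X E ↔
            ∃ φ : StrongDual 𝕜 (UniformSpace.Completion (α.Space X (StrongDual 𝕜 E))),
              ∀ u : LipTensor 𝕜 X (StrongDual 𝕜 E),
                φ (α.toSpace X (StrongDual 𝕜 E) u :
                    UniformSpace.Completion (α.Space X (StrongDual 𝕜 E)))
                  = u.1 (Lip0.toBidual f)) := by
  constructor
  · exact exists_isometryEquiv_of_bounded_iff (E := StrongDual 𝕜 E)
      (LinearMap.flip (LipTensor 𝕜 X E).subtype) (bounded_iff_of_dual hA hα hAα)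
      exists_lip0_of_dual_completion
  · let β : Lip0 𝕜 X E →ₗ[𝕜] LipTensor 𝕜 X (StrongDual 𝕜 E) →ₗ[𝕜] 𝕜 :=
      { toFun := fun f =>
          { toFun := fun u => u.1 (Lip0.toBidual f)
            map_add' := fun _ _ => rfl
            map_smul' := fun _ _ => rfl }
        map_add' := fun f g => LinearMap.ext fun u =>
          (congrArg u.1 (map_add Lip0.toBidual f g)).trans (map_add u.1 _ _)
        map_smul' := fun c f => LinearMap.ext fun u =>
          (congrArg u.1 (map_smul Lip0.toBidual c f)).trans (map_smul u.1 _ _) }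
    have hβ : ∀ f C, 0 ≤ C →
        (A.Bounded f C ↔ ∀ u, ‖β f u‖ ≤ C * α.norm X (StrongDual 𝕜 E) u) :=
      fun f C hC => bounded_iff_bidualBounded hA hα hAα hC
    exact exists_isometry_of_bounded_iff β hβ
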